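/- Let $f:\mathbb R^n\to\mathbb R$, $g:\mathbb R^n\to\mathbb R^{m_e}$, $h:\mathbb R^n\to\mathbb R^{m_i}$ ($m_i\ge 1$) be twice continuously differentiable and consider $\min_{x\in\mathbb R^n} f(x)$ subject to $g(x)=0$, $h(x)+s=0$, $s\ge 0$. Write $p=(x,s,y,z)$, $$L(p,v)=f(x)+y^\top g(x)+z^\top(h(x)+s)-v^\top s,$$ and, at a point $(p,v)$, $W=\nabla^2_{xx}L$, $G=\nabla g(x)$, $H=\nabla h(x)$ (Jacobian matrices), $S=\mathrm{diag}(s)$, $V=\mathrm{diag}(v)$, $D_s=S^{-1}V$, $\Xi=s^\top v/m_i$, and for $\gamma>0$ $$K_\gamma=W+H^\top D_sH+\gamma G^\top G,\qquad S_\gamma=GK_\gamma^{-1}G^\top .$$ All norms are Euclidean (spectral for matrices). Let $(p^\star,v^\star)$ satisfy the KKT conditions $\nabla_xL=0$, $z^\star=v^\star$, $g(x^\star)=0$, $h(x^\star)+s^\star=0$, $0\le s^\star\perp v^\star\ge 0$, and put $\mathcal B=\{i: h_i(x^\star)=0\}$, $\mathcal N=\{1,\dots,m_i\}\setminus\mathcal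 B$. Assume that $\nabla^2_{xx}L$ is Lipschitz continuous near $(p^\star,v^\star)$; that the active Jacobian $A(x^\star)$, with rows those of $\nabla g(x^\star)$ and the $\nabla h_i(x^\star)$, $i\in\mathcal B$, has full row rank; that $z_i^\star>0$ for $i\in\mathcal B$; and that $d^\top\nabla^2_{xx}L(p^\star,v^\star)d>0$ for every $0\ne d\in\ker A(x^\star)$. Fix constants $C>0$, $\alpha\in(0,1)$, $0<a\le b$, $c\ge 0$, $\varepsilon\ge 0$. Then there are constants $M,r,\kappa>0$, depending only on the problem, on $(p^\star,v^\star)$ and on $C,\alpha,a,b,c,\varepsilon$, such that the following holds for all $(p,v)$, $\gamma$ and $\mathbf u>0$ with * $\|(p,v)-(p^\star,v^\star)\|\le r$; * (centrality) $\|\nabla_pL(p,v)\|\le C\,\Xi$, $(s,v)>0$, and $s_iv_i\ge\alpha\,\Xi$ for all $i$; * $a\,\Xi^{-1}\le\gamma\le b\,\Xi^{-1}$; * $\mathbf u\le\kappa\,\Xi$. Let $\overline\sigma=\max(1/\min_{i\in\mathcal B}s_i,\gamma)$ (and $\overline\sigma=\gamma$ if $\mathcal B=\emptyset$), and let the floating-point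 evaluation be $$\widehat K_\gamma=\widehat W+\widehat H^\top\widehat D_s\widehat H+\widehat G^\top\widehat\Gamma\,\widehat G ,$$ with $\|\widehat W-W\|$, $\|\widehat G-G\|$, $\|\widehat H-H\|\le c\,\mathbf u$ and diagonal matrices $\widehat D_s$, $\widehat\Gamma$ satisfying $|(\widehat D_s-D_s)_{ii}|\le c\,\mathbf u\,\overline\sigma$ for $i\in\mathcal B$, $|(\widehat D_s-D_s)_{ii}|\le c\,\mathbf u\,\Xi$ for $i\in\mathcal N$, and $|(\widehat\Gamma-\gamma I)_{jj}|\le c\,\mathbf u\,\overline\sigma$ for all $j$. Let linear systems with the condensed matrix be solved by a backward stable method: for each $j\in\{1,\dots,m_e\}$ the computed $\widehat x_j$ solves $(\widehat K_\gamma+E_j)\widehat x_j=\widehat G^\top e_j$, where $E_j$ is symmetric and $\|E_j\|\le\mathbf u\,\varepsilon\,\|K_\gamma\|$. Let $\widehat S_\gamma$ be the matrix with columns $\widehat G\,\widehat x_j$ (so $\widehat S_\gamma=\widehat G(\widehat K_\gamma+E)^{-1}\widehat G^\top$ if all $E_j$ equal $E$). Then $K_\gamma$ and all $\widehat K_\gamma+E_j$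 are invertible and $$\|\widehat S_\gamma-S_\gamma\|\le M\,\mathbf u,\qquad\text{i.e. } \widehat S_\gamma=S_\gamma+O(\mathbf u).$$ -/

import Mathlib

open scoped Matrix Matrix.Norms.L2Operator

noncomputable section

/-- Data of the nonlinear program: minimise `f x` subject to `g x = 0`, `h x ≤ 0`, `x ∈ ℝⁿ`
(bounds on `x`, if any, are part of `h`). With slacks: `g x = 0`, `h x + s = 0`, `s ≥ 0`. -/
structure NLP (n me mi : ℕ) where
  f : EuclideanSpace ℝ (Fin n) → ℝ
  g : EuclideanSpace ℝ (Fin n) → EuclideanSpace ℝ (Fin me)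
  h : EuclideanSpace ℝ (Fin n) → EuclideanSpace ℝ (Fin mi)

/-- A primal-dual point `(p, v)` with `p = (x, s, y, z)`: primal variable, slack, multipliers of
`g x = 0` and of `h x + s = 0`, multiplier of `s ≥ 0`. -/
structure PDPoint (n me mi : ℕ) where
  x : EuclideanSpace ℝ (Fin n)
  s : EuclideanSpace ℝ (Fin mi)
  y : EuclideanSpace ℝ (Fin me)
  z : EuclideanSpace ℝ (Fin mi)
  v : EuclideanSpace ℝ (Fin mi)

/-- Euclidean distance between two primal-dual points. -/
def PDPoint.eucDist {n me mi : ℕ} (w w' : PDPoint n me mi) : ℝ :=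
  Real.sqrt (‖w.x - w'.x‖ ^ 2 + ‖w.s - w'.s‖ ^ 2 + ‖w.y - w'.y‖ ^ 2
    + ‖w.z - w'.z‖ ^ 2 + ‖w.v - w'.v‖ ^ 2)

/-- The duality measure `Ξ(s, v) = sᵀ v / m_i`. -/
def PDPoint.dualityMeasure {n me mi : ℕ} (w : PDPoint n me mi) : ℝ :=
  (∑ i, w.s i * w.v i) / (mi : ℝ)

/-- The `m × n` Jacobian matrix of a map `ℝⁿ → ℝᵐ`. -/
def jacobianMatrix {n m : ℕ} (φ : EuclideanSpace ℝ (Fin n) → EuclideanSpace ℝ (Fin m))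
    (x : EuclideanSpace ℝ (Fin n)) : Matrix (Fin m) (Fin n) ℝ :=
  Matrix.of fun i j => (fderiv ℝ φ x (EuclideanSpace.single j 1)) i

/-- The Hessian matrix of a function `ℝⁿ → ℝ`. -/
def hessianMatrix {n : ℕ} (φ : EuclideanSpace ℝ (Fin n) → ℝ)
    (x : EuclideanSpace ℝ (Fin n)) : Matrix (Fin n) (Fin n) ℝ :=
  Matrix.of fun i j =>
    fderiv ℝ (fderiv ℝ φ) x (EuclideanSpace.single i 1) (EuclideanSpace.single j 1)

namespace NLP

variable {n me mi : ℕ} (P : NLP n me mi)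

/-- The Lagrangian `f(x) + yᵀ g(x) + zᵀ (h(x) + s) - vᵀ s`. -/
def lagrangian (x : EuclideanSpace ℝ (Fin n)) (s : EuclideanSpace ℝ (Fin mi))
    (y : EuclideanSpace ℝ (Fin me)) (z v : EuclideanSpace ℝ (Fin mi)) : ℝ :=
  P.f x + inner ℝ y (P.g x) + inner ℝ z (P.h x + s) - inner ℝ v s

/-- `∇ₓ L`. -/
def gradX (w : PDPoint n me mi) : EuclideanSpace ℝ (Fin n) :=
  gradient (fun x => P.lagrangian x w.s w.y w.z w.v) w.x

/-- The Euclidean norm of `∇ₚ L(p, v)`, `p = (x, s, y, z)`. -/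
def gradNorm (w : PDPoint n me mi) : ℝ :=
  Real.sqrt (‖P.gradX w‖ ^ 2
    + ‖gradient (fun s => P.lagrangian w.x s w.y w.z w.v) w.s‖ ^ 2
    + ‖gradient (fun y => P.lagrangian w.x w.s y w.z w.v) w.y‖ ^ 2
    + ‖gradient (fun z => P.lagrangian w.x w.s w.y z w.v) w.z‖ ^ 2)

/-- `W = ∇²ₓₓ L`. -/
def W (w : PDPoint n me mi) : Matrix (Fin n) (Fin n) ℝ :=
  hessianMatrix (fun x => P.lagrangian x w.s w.y w.z w.v) w.x

/-- `G = ∇g(x)`. -/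
def G (w : PDPoint n me mi) : Matrix (Fin me) (Fin n) ℝ := jacobianMatrix P.g w.x

/-- `H = ∇h(x)`. -/
def H (w : PDPoint n me mi) : Matrix (Fin mi) (Fin n) ℝ := jacobianMatrix P.h w.x

/-- The active set `ℬ(x) = {i | hᵢ(x) = 0}`. -/
def activeSet (x : EuclideanSpace ℝ (Fin n)) : Set (Fin mi) := {i | P.h x i = 0}

/-- The active Jacobian: rows of `∇g(x)` together with the rows of `∇h(x)` in `ℬ(x)`. -/
def activeJacobian (w : PDPoint n me mi) :
    Matrix (Fin me ⊕ P.activeSet w.x) (Fin n) ℝ :=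
  Matrix.fromRows (P.G w) ((P.H w).submatrix (fun i : P.activeSet w.x => (i : Fin mi)) id)

/-- The KKT conditions of the slack formulation (`x` free). -/
structure IsKKT (w : PDPoint n me mi) : Prop where
  stationary_x : P.gradX w = 0
  stationary_s : w.z - w.v = 0
  feasible_g : P.g w.x = 0
  feasible_h : P.h w.x + w.s = 0
  s_nonneg : ∀ i, 0 ≤ w.s i
  v_nonneg : ∀ i, 0 ≤ w.v i
  compl : ∀ i, w.s i * w.v i = 0

/-- A regular primal-dual solution: KKT point with Lipschitz Hessian of the Lagrangian nearby,
LICQ, strict complementarity and the second-order sufficient condition. -/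
structure IsRegularSolution (w : PDPoint n me mi) : Prop where
  kkt : P.IsKKT w
  lipschitz : ∃ K r : ℝ, 0 < r ∧ ∀ w₁ w₂ : PDPoint n me mi,
    w₁.eucDist w ≤ r → w₂.eucDist w ≤ r → ‖P.W w₁ - P.W w₂‖ ≤ K * w₁.eucDist w₂
  licq : LinearIndependent ℝ (P.activeJacobian w).row
  strict_compl : ∀ i ∈ P.activeSet w.x, 0 < w.z i
  sosc : ∀ d : Fin n → ℝ, d ≠ 0 → P.activeJacobian w *ᵥ d = 0 → 0 < d ⬝ᵥ (P.W w *ᵥ d)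

/-- The centrality conditions with constants `C` and `α`. -/
structure IsCentral (C α : ℝ) (w : PDPoint n me mi) : Prop where
  grad_le : P.gradNorm w ≤ C * w.dualityMeasure
  s_pos : ∀ i, 0 < w.s i
  v_pos : ∀ i, 0 < w.v i
  compl_ge : ∀ i, α * w.dualityMeasure ≤ w.s i * w.v i

/-- `K_γ = W + Hᵀ D_s H + γ Gᵀ G` with `D_s = S⁻¹ V`. -/
def K (γ : ℝ) (w : PDPoint n me mi) : Matrix (Fin n) (Fin n) ℝ :=
  P.W w + (P.H w)ᵀ * Matrix.diagonal (fun i => (w.s i)⁻¹ * w.v i) * P.H w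
    + γ • ((P.G w)ᵀ * P.G w)

/-- The Schur complement `S_γ = G K_γ⁻¹ Gᵀ`. -/
def S (γ : ℝ) (w : PDPoint n me mi) : Matrix (Fin me) (Fin me) ℝ :=
  P.G w * (P.K γ w)⁻¹ * (P.G w)ᵀ

/-- `σ̄ = max (1 / s_min) γ`, where `s_min` is the smallest slack over the active set `B`.
If `B` is empty the infimum below is `0`, and `σ̄ = γ` for `γ > 0`, as it should be. -/
def sigmaBar (γ : ℝ) (B : Set (Fin mi)) (w : PDPoint n me mi) : ℝ :=
  max (1 / ⨅ i : B, w.s i) γ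

end NLP

/-- The computed ingredients of the condensed matrix: `Ŵ`, `Ĝ`, `Ĥ`, the diagonal of `D̂_s`, and
the diagonal of the computed equality block `γ I`. -/
structure FloatData (n me mi : ℕ) where
  W : Matrix (Fin n) (Fin n) ℝ
  G : Matrix (Fin me) (Fin n) ℝ
  H : Matrix (Fin mi) (Fin n) ℝ
  Ds : Fin mi → ℝ
  Γ : Fin me → ℝ

namespace FloatData

variable {n me mi : ℕ} (F : FloatData n me mi)

/-- Rounding-error model with unit roundoff `u` and constant `c`, `B` being the active set at the
solution: `ΔW`, `ΔG`, `ΔH` are `O(u)`; the diagonal entries of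
`D_γ = diag(S_ℬ⁻¹ V_ℬ, γ I)` are perturbed by `O(u σ̄)`; the inactive entries of `D_s` are
perturbed by `O(u Ξ)` (in particular they may be exact). -/
structure IsRounding (P : NLP n me mi) (B : Set (Fin mi)) (c u γ : ℝ)
    (w : PDPoint n me mi) : Prop where
  W_err : ‖F.W - P.W w‖ ≤ c * u
  G_err : ‖F.G - P.G w‖ ≤ c * u
  H_err : ‖F.H - P.H w‖ ≤ c * u
  Ds_active_err : ∀ i ∈ B, |F.Ds i - (w.s i)⁻¹ * w.v i| ≤ c * u * NLP.sigmaBar γ B w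
  Ds_inactive_err : ∀ i ∉ B, |F.Ds i - (w.s i)⁻¹ * w.v i| ≤ c * u * w.dualityMeasure
  Γ_err : ∀ j, |F.Γ j - γ| ≤ c * u * NLP.sigmaBar γ B w

/-- The assembled matrix `K̂_γ = Ŵ + Ĥᵀ D̂_s Ĥ + Ĝᵀ Γ̂ Ĝ`. -/
def K : Matrix (Fin n) (Fin n) ℝ :=
  F.W + F.Hᵀ * Matrix.diagonal F.Ds * F.H + F.Gᵀ * Matrix.diagonal F.Γ * F.G

/-- The computed Schur complement. Its `j`-th column is `Ĝ x̂ⱼ`, where `x̂ⱼ` is the computed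
solution of the condensed system with right-hand side `Ĝᵀ eⱼ`, that is, the exact solution of
`(K̂_γ + Δₛ) x̂ⱼ = Ĝᵀ eⱼ`; the backward error `Δₛ = E j` may depend on the right-hand side. -/
def S (E : Fin me → Matrix (Fin n) (Fin n) ℝ) : Matrix (Fin me) (Fin me) ℝ :=
  Matrix.of fun i j => (F.G *ᵥ ((F.K + E j)⁻¹ *ᵥ F.Gᵀ.col j)) i

/-- If the backward error is the same for all right-hand sides, then `Ŝ = Ĝ (K̂ + Δₛ)⁻¹ Ĝᵀ`. -/
theorem S_const (E : Matrix (Fin n) (Fin n) ℝ) :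
    F.S (fun _ => E) = F.G * (F.K + E)⁻¹ * F.Gᵀ := by
  ext i j
  rw [Matrix.mul_assoc]
  rfl

end FloatData

/-- Backward stability of the linear solver used for systems with matrix `K`: the perturbation
`E` is symmetric and bounded by `u ε ‖K‖`. -/
def IsBackwardError {n : ℕ} (ε u : ℝ) (K E : Matrix (Fin n) (Fin n) ℝ) : Prop :=
  E.IsSymm ∧ ‖E‖ ≤ u * ε * ‖K‖

end

/-! ### Comparison of spectral, sup and entrywise norms -/

section MatrixNorms

variable {m n : Type*} [Fintype m] [Fintype n] [DecidableEq n]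

/-! The entries of `K_γ` are of size `1/Ξ`, so perturbing its inverse directly is hopeless. Instead,
each condensed system `K x = Gᵀ e` is unfolded: with `ω = 1/γ`, `μ = Γ G x - e` and `ν = D H x`, the
triple `(x, μ, ν)` solves a primal-dual system (`saddleMap_condensed`) whose data `(W, G, H, ωΓ, ω,
sD, s)` stay bounded and whose right-hand side `(0, ω e, 0)` is `O(Ξ)`.

Near the solution these data approach `(W, G, H, 1, 0, v, s)` at `wstar`, where the system is
nonsingular by LICQ, strict complementarity and the second-order condition
(`saddleMap_injective_of_regular`). Hence nearby systems are uniformly nonsingular and their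
solutions are Lipschitz in the data (`exists_saddleMap_stability`).

Rounding and backward errors move the data by `O(u/Ξ)` (`norm_saddleData_sub_le`); the worst
contribution is the backward error, since `‖K_γ‖ = O(1/Ξ)`. Acting on solutions of size `O(Ξ)`, they
change `x` by only `O(u)`, hence also `G x`, a column of the Schur complement. -/

theorem abs_entry_le_l2_opNorm (A : Matrix m n ℝ) (i : m) (j : n) : |A i j| ≤ ‖A‖ := by
  have h := Matrix.l2_opNorm_mulVec A (EuclideanSpace.single j (1 : ℝ))
  rw [PiLp.norm_single, norm_one, mul_one] at h
  refine le_trans ?_ h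
  have h2 := PiLp.norm_apply_le (WithLp.toLp 2 (A *ᵥ (EuclideanSpace.single j (1 : ℝ)).ofLp)) i
  simpa using h2

/-- Vectors carry the sup norm and matrices the spectral norm; the factor `card n` is the price of
mixing them. -/
theorem norm_mulVec_le_card_mul (A : Matrix m n ℝ) (x : n → ℝ) :
    ‖A *ᵥ x‖ ≤ Fintype.card n * ‖A‖ * ‖x‖ := by
  rw [pi_norm_le_iff_of_nonneg (by positivity)]
  intro i
  calc ‖(A *ᵥ x) i‖ ≤ ∑ j, ‖A i j * x j‖ := norm_sum_le _ _
    _ ≤ ∑ _j : n, ‖A‖ * ‖x‖ := by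
        refine Finset.sum_le_sum fun j _ => ?_
        rw [norm_mul]
        exact mul_le_mul (abs_entry_le_l2_opNorm A i j) (norm_le_pi_norm x j)
          (norm_nonneg _) (norm_nonneg _)
    _ = _ := by simp [mul_assoc]

theorem norm_transpose_l2 [DecidableEq m] (A : Matrix m n ℝ) : ‖Aᵀ‖ = ‖A‖ := by
  have := Matrix.l2_opNorm_conjTranspose A
  rwa [Matrix.conjTranspose_eq_transpose_of_trivial] at this

/-- Each column of the computed Schur complement has its own backward error, so the final estimate
is made entry by entry. -/
theorem exists_l2_opNorm_le_of_entries (m n : Type*) [Fintype m] [Fintype n] [DecidableEq m]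
    [DecidableEq n] :
    ∃ c : ℝ, 0 ≤ c ∧ ∀ (A : Matrix m n ℝ) (t : ℝ), (∀ i j, |A i j| ≤ t) → ‖A‖ ≤ c * t := by
  refine ⟨∑ i : m, ∑ j : n, ‖(Matrix.single i j 1 : Matrix m n ℝ)‖,
    Finset.sum_nonneg fun i _ => Finset.sum_nonneg fun j _ => norm_nonneg _, fun A t h => ?_⟩
  conv_lhs => rw [Matrix.matrix_eq_sum_single A]
  simp only [Finset.sum_mul]
  refine (norm_sum_le _ _).trans (Finset.sum_le_sum fun i _ => ?_)
  refine (norm_sum_le _ _).trans (Finset.sum_le_sum fun j _ => ?_)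
  have : Matrix.single i j (A i j) = A i j • Matrix.single i j (1 : ℝ) := by
    rw [Matrix.smul_single]; simp
  rw [this, norm_smul, mul_comm]
  exact mul_le_mul_of_nonneg_left (h i j) (norm_nonneg _)

end MatrixNorms

/-! ### Primal-dual systems and their stability -/

section SaddleSystem

universe u

variable {n m k : Type u} [Fintype n] [Fintype m] [Fintype k]

/-- Coefficients `(W, G, H, θ, ω, v, s)` of a primal-dual system. -/
abbrev SaddleData (n m k : Type*) : Type _ :=
  Matrix n n ℝ × Matrix m n ℝ × Matrix k n ℝ × (m → ℝ) × ℝ × (k → ℝ) × (k → ℝ)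

/-- The primal-dual system
`(x, μ, ν) ↦ (W x + Gᵀ μ + Hᵀ ν, θ ⊙ G x - ω μ, v ⊙ H x - s ⊙ ν)`. -/
def saddleMap : SaddleData n m k →
    ((n → ℝ) × (m → ℝ) × (k → ℝ)) →ₗ[ℝ] ((n → ℝ) × (m → ℝ) × (k → ℝ))
  | (W, G, H, θ, ω, v, s) =>
    { toFun := fun z => (W *ᵥ z.1 + Gᵀ *ᵥ z.2.1 + Hᵀ *ᵥ z.2.2,
        θ * (G *ᵥ z.1) - ω • z.2.1, v * (H *ᵥ z.1) - s * z.2.2)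
      map_add' := fun z z' => by
        refine Prod.ext ?_ (Prod.ext ?_ ?_)
        · simp only [Prod.fst_add, Prod.snd_add, Matrix.mulVec_add]; abel
        · simp only [Prod.fst_add, Prod.snd_add, Matrix.mulVec_add, smul_add]; ring
        · simp only [Prod.fst_add, Prod.snd_add, Matrix.mulVec_add]; ring
      map_smul' := fun a z => by
        refine Prod.ext ?_ (Prod.ext ?_ ?_)
        · simp only [Prod.smul_fst, Prod.smul_snd, Matrix.mulVec_smul, smul_add, RingHom.id_apply]
        · ext j
          simp [Matrix.mulVec_smul]; ring
        · ext j
          simp [Matrix.mulVec_smul]; ring }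

theorem saddleMap_apply (W : Matrix n n ℝ) (G : Matrix m n ℝ) (H : Matrix k n ℝ) (θ : m → ℝ)
    (ω : ℝ) (v s : k → ℝ) (x : n → ℝ) (μ : m → ℝ) (ν : k → ℝ) :
    saddleMap (W, G, H, θ, ω, v, s) (x, μ, ν) =
      (W *ᵥ x + Gᵀ *ᵥ μ + Hᵀ *ᵥ ν, θ * (G *ᵥ x) - ω • μ, v * (H *ᵥ x) - s * ν) := rfl

/-- The large weights `Γ` and `D` enter the data only after multiplication by `ω` and `s`, and
subtracting `e` in `μ` makes the right-hand side proportional to `ω`. -/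
theorem saddleMap_condensed [DecidableEq m] [DecidableEq k] (W : Matrix n n ℝ) (G : Matrix m n ℝ) (H : Matrix k n ℝ)
    (D s : k → ℝ) (Γ : m → ℝ) (ω : ℝ) (x : n → ℝ) (e : m → ℝ)
    (hx : (W + Hᵀ * Matrix.diagonal D * H + Gᵀ * Matrix.diagonal Γ * G) *ᵥ x = Gᵀ *ᵥ e) :
    saddleMap (W, G, H, ω • Γ, ω, s * D, s) (x, Γ * (G *ᵥ x) - e, D * (H *ᵥ x))
      = (0, ω • e, 0) := by
  have hd : ∀ {l : Type u} [Fintype l] [DecidableEq l] (d y : l → ℝ),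
      Matrix.diagonal d *ᵥ y = d * y := by
    intro l _ _ d y
    ext i
    simp [Matrix.mulVec_diagonal]
  simp only [Matrix.add_mulVec, ← Matrix.mulVec_mulVec, hd] at hx
  rw [saddleMap_apply]
  refine Prod.ext ?_ (Prod.ext ?_ ?_)
  · simp only [Matrix.mulVec_sub, ← hx]
    abel
  · ext j
    simp; ring
  · ext j
    simp; ring

variable [DecidableEq n]

theorem norm_mul_mulVec_sub_le {l : Type*} [Fintype l] [DecidableEq l] (A B : Matrix l n ℝ)
    (θ τ : l → ℝ) (x : n → ℝ) :
    ‖θ * (A *ᵥ x) - τ * (B *ᵥ x)‖ ≤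
      Fintype.card n * (‖θ - τ‖ * ‖A‖ + ‖τ‖ * ‖A - B‖) * ‖x‖ := by
  have e : θ * (A *ᵥ x) - τ * (B *ᵥ x) = (θ - τ) * (A *ᵥ x) + τ * ((A - B) *ᵥ x) := by
    rw [Matrix.sub_mulVec]; ring
  rw [e]
  calc _ ≤ ‖θ - τ‖ * ‖A *ᵥ x‖ + ‖τ‖ * ‖(A - B) *ᵥ x‖ :=
        (norm_add_le _ _).trans (add_le_add (norm_mul_le _ _) (norm_mul_le _ _))
    _ ≤ ‖θ - τ‖ * (Fintype.card n * ‖A‖ * ‖x‖)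
        + ‖τ‖ * (Fintype.card n * ‖A - B‖ * ‖x‖) := by
        gcongr <;> exact norm_mulVec_le_card_mul _ _
    _ = _ := by ring

theorem norm_saddle_row_sub_le {l : Type*} [Fintype l] [DecidableEq l] {A B : Matrix l n ℝ}
    {τ τ' y y' : l → ℝ} {x : n → ℝ} {η a b N Z : ℝ} (hη : 0 ≤ η) (ha : 0 ≤ a) (hb : 0 ≤ b)
    (hZ : 0 ≤ Z) (hN : Fintype.card n + 1 ≤ N) (h1 : ‖A - B‖ ≤ η) (h2 : ‖τ - τ'‖ ≤ η)
    (h3 : ‖A‖ ≤ a) (h4 : ‖τ'‖ ≤ b) (hx : ‖x‖ ≤ Z) (h5 : ‖y - y'‖ ≤ η * Z) :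
    ‖(τ * (A *ᵥ x) - y) - (τ' * (B *ᵥ x) - y')‖ ≤ N * (1 + a + b) * η * Z := by
  rw [sub_sub_sub_comm]
  have hn : (0 : ℝ) ≤ Fintype.card n := Nat.cast_nonneg _
  calc _ ≤ Fintype.card n * (‖τ - τ'‖ * ‖A‖ + ‖τ'‖ * ‖A - B‖) * ‖x‖ + η * Z :=
        (norm_sub_le _ _).trans (add_le_add (norm_mul_mulVec_sub_le _ _ _ _ _) h5)
    _ ≤ Fintype.card n * (η * a + b * η) * Z + η * Z := by gcongr
    _ = Fintype.card n * ((a + b) * η * Z) + 1 * (η * Z) := by ring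
    _ ≤ N * ((a + b) * η * Z) + N * (η * Z) := by gcongr <;> linarith
    _ = _ := by ring

variable [DecidableEq m] [DecidableEq k]

/-- The map is at most quadratic in its data, through the products `θ ⊙ G` and `v ⊙ H`, so its
Lipschitz constant grows linearly with their norms. -/
theorem norm_saddleMap_sub_le (p q : SaddleData n m k) (z : (n → ℝ) × (m → ℝ) × (k → ℝ)) :
    ‖saddleMap p z - saddleMap q z‖ ≤
      (Fintype.card n + Fintype.card m + Fintype.card k + 1) * (1 + ‖p‖ + ‖q‖)
        * ‖p - q‖ * ‖z‖ := by
  have hd := le_refl ‖p - q‖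
  have hp := le_refl ‖p‖
  have hq := le_refl ‖q‖
  have hz := le_refl ‖z‖
  have hd0 := norm_nonneg (p - q)
  have hp0 := norm_nonneg p
  have hq0 := norm_nonneg q
  have hz0 := norm_nonneg z
  generalize hη : ‖p - q‖ = η at hd0
  generalize ha : ‖p‖ = a at hp0
  generalize hb : ‖q‖ = b at hq0
  generalize hZ : ‖z‖ = Z at hz0
  replace hd := hd.trans_eq hη
  replace hp := hp.trans_eq ha
  replace hq := hq.trans_eq hb
  replace hz := hz.trans_eq hZ
  clear hη ha hb hZ
  obtain ⟨W, G, H, θ, ω, v, s⟩ := p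
  obtain ⟨W', G', H', θ', ω', v', s'⟩ := q
  obtain ⟨x, μ, ν⟩ := z
  simp only [Prod.mk_sub_mk, norm_prod_le_iff] at hd hp hq hz
  obtain ⟨dW, dG, dH, dθ, dω, dv, ds⟩ := hd
  obtain ⟨-, pG, pH, -, -, -, -⟩ := hp
  obtain ⟨-, -, -, qθ, -, qv, -⟩ := hq
  obtain ⟨zx, zμ, zν⟩ := hz
  have N0 : (0 : ℝ) ≤ Fintype.card n := Nat.cast_nonneg _
  have M0 : (0 : ℝ) ≤ Fintype.card m := Nat.cast_nonneg _
  have K0 : (0 : ℝ) ≤ Fintype.card k := Nat.cast_nonneg _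
  rw [saddleMap_apply, saddleMap_apply, Prod.mk_sub_mk, Prod.mk_sub_mk, norm_prod_le_iff,
    norm_prod_le_iff]
  refine ⟨?_, norm_saddle_row_sub_le hd0 hp0 hq0 hz0 (by linarith) dG dθ pG qθ zx ?_,
    norm_saddle_row_sub_le hd0 hp0 hq0 hz0 (by linarith) dH dv pH qv zx ?_⟩
  · have e : W *ᵥ x + Gᵀ *ᵥ μ + Hᵀ *ᵥ ν - (W' *ᵥ x + G'ᵀ *ᵥ μ + H'ᵀ *ᵥ ν)
      = (W - W') *ᵥ x + (G - G')ᵀ *ᵥ μ + (H - H')ᵀ *ᵥ ν := by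
      simp only [Matrix.transpose_sub, Matrix.sub_mulVec]; abel
    dsimp only
    rw [e]
    calc _ ≤ Fintype.card n * ‖W - W'‖ * ‖x‖ + Fintype.card m * ‖(G - G')ᵀ‖ * ‖μ‖
          + Fintype.card k * ‖(H - H')ᵀ‖ * ‖ν‖ :=
          (norm_add₃_le).trans (add_le_add (add_le_add (norm_mulVec_le_card_mul _ _)
            (norm_mulVec_le_card_mul _ _)) (norm_mulVec_le_card_mul _ _))
      _ ≤ Fintype.card n * η * Z + Fintype.card m * η * Z + Fintype.card k * η * Z := by
          rw [norm_transpose_l2, norm_transpose_l2]; gcongr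
      _ = (Fintype.card n + Fintype.card m + Fintype.card k) * 1 * η * Z := by ring
      _ ≤ _ := mul_le_mul_of_nonneg_right (mul_le_mul_of_nonneg_right
          (mul_le_mul (by linarith) (by linarith) zero_le_one (by linarith)) hd0) hz0
  · rw [← sub_smul, norm_smul]
    exact mul_le_mul dω zμ (norm_nonneg _) hd0
  · rw [← sub_mul]
    exact (norm_mul_le _ _).trans (mul_le_mul ds zν (norm_nonneg _) hd0)

/-- A nonsingular primal-dual system is uniformly nonsingular near its data, and its solutions
depend on the data in a Lipschitz way. -/
theorem exists_saddleMap_stability (p₀ : SaddleData n m k)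
    (hp₀ : Function.Injective (saddleMap p₀)) :
    ∃ C δ : ℝ, 0 < C ∧ 0 < δ ∧
      (∀ p : SaddleData n m k, ‖p - p₀‖ ≤ δ → ∀ z, ‖z‖ ≤ C * ‖saddleMap p z‖) ∧
      ∀ p q : SaddleData n m k, ‖p - p₀‖ ≤ δ → ‖q - p₀‖ ≤ δ → ∀ z y,
        saddleMap p z = saddleMap q y → ‖y - z‖ ≤ C * ‖q - p‖ * ‖saddleMap q y‖ := by
  obtain ⟨c, c0, hc⟩ := (saddleMap p₀).exists_antilipschitzWith (LinearMap.ker_eq_bot.2 hp₀)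
  have hbd : ∀ z, ‖z‖ ≤ c * ‖saddleMap p₀ z‖ := fun z => by
    simpa using hc.le_mul_dist z 0
  have c0' : (0 : ℝ) < c := c0
  set L : ℝ := (Fintype.card n + Fintype.card m + Fintype.card k + 1) *
    (1 + (‖p₀‖ + 1) + (‖p₀‖ + 1)) with hL
  have L0 : 0 < L := by positivity
  have hlip : ∀ p q : SaddleData n m k, ‖p - p₀‖ ≤ 1 → ‖q - p₀‖ ≤ 1 → ∀ z,
      ‖saddleMap p z - saddleMap q z‖ ≤ L * ‖p - q‖ * ‖z‖ := by
    intro p q hp hq z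
    refine (norm_saddleMap_sub_le p q z).trans ?_
    have h1 : ‖p‖ ≤ ‖p₀‖ + 1 := by
      have := norm_le_norm_add_norm_sub' p p₀
      linarith
    have h2 : ‖q‖ ≤ ‖p₀‖ + 1 := by
      have := norm_le_norm_add_norm_sub' q p₀
      linarith
    rw [hL]
    gcongr
  -- Within `1 / (2cL)` the perturbation term is at most half of `‖z‖` and can be absorbed; the
  -- bound `1` keeps the Lipschitz constant `L` valid.
  set δ : ℝ := min 1 (1 / (2 * c * L))
  have δ0 : 0 < δ := by positivity
  have δ1 : δ ≤ 1 := min_le_left _ _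
  have hstab : ∀ p : SaddleData n m k, ‖p - p₀‖ ≤ δ → ∀ z, ‖z‖ ≤ 2 * c * ‖saddleMap p z‖ := by
    intro p hp z
    have h1 := hlip p₀ p (by simp) (hp.trans δ1) z
    have h2 : c * (L * ‖p₀ - p‖ * ‖z‖) ≤ 1 / 2 * ‖z‖ := by
      have : c * L * ‖p₀ - p‖ ≤ 1 / 2 := by
        rw [norm_sub_rev]
        calc c * L * ‖p - p₀‖ ≤ c * L * (1 / (2 * c * L)) := by
              gcongr; exact hp.trans (min_le_right _ _)
          _ = 1 / 2 := by field_simp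
      calc _ = c * L * ‖p₀ - p‖ * ‖z‖ := by ring
        _ ≤ _ := by gcongr
    have h3 : ‖saddleMap p₀ z‖ ≤ ‖saddleMap p z‖ + ‖saddleMap p₀ z - saddleMap p z‖ :=
      norm_le_norm_add_norm_sub' _ _
    have h4 := mul_le_mul_of_nonneg_left (h3.trans (add_le_add_right h1 _)) c0'.le
    have := hbd z
    linarith
  -- The sum of the constants of the two claims serves both.
  refine ⟨2 * c + 2 * c * L * (2 * c), δ, by positivity, δ0, fun p hp z => ?_,
    fun p q hp hq z y h => ?_⟩
  · refine (hstab p hp z).trans ?_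
    gcongr
    exact le_add_of_nonneg_right (by positivity)
  · have h1 := hstab p hp (y - z)
    -- The residual of `y - z` under `p` is the difference of the two maps at `y`.
    rw [map_sub, h] at h1
    have h2 := hlip p q (hp.trans δ1) (hq.trans δ1) y
    rw [norm_sub_rev p q] at h2
    have h3 := hstab q hq y
    calc ‖y - z‖ ≤ 2 * c * (L * ‖q - p‖ * (2 * c * ‖saddleMap q y‖)) := by
          refine h1.trans ?_
          gcongr
          exact h2.trans (by gcongr)
      _ = 2 * c * L * (2 * c) * ‖q - p‖ * ‖saddleMap q y‖ := by ring
      _ ≤ _ := by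
          gcongr
          exact le_add_of_nonneg_left (by positivity)

end SaddleSystem

/-! ### Neighbourhoods of a regular solution and the limiting system -/

section PrimalDualPoints

variable {n me mi : ℕ}

namespace PDPoint

variable {w w' : PDPoint n me mi} {r : ℝ}

theorem norm_x_sub_le (h : w.eucDist w' ≤ r) : ‖w.x - w'.x‖ ≤ r :=
  (Real.le_sqrt_of_sq_le (by
      linarith [sq_nonneg (‖w.s - w'.s‖), sq_nonneg (‖w.y - w'.y‖),
        sq_nonneg (‖w.z - w'.z‖), sq_nonneg (‖w.v - w'.v‖)])).trans h

theorem norm_s_sub_le (h : w.eucDist w' ≤ r) : ‖w.s.ofLp - w'.s.ofLp‖ ≤ r := by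
  have h1 : ‖w.s - w'.s‖ ≤ r :=
    (Real.le_sqrt_of_sq_le (by
      linarith [sq_nonneg (‖w.x - w'.x‖), sq_nonneg (‖w.y - w'.y‖),
        sq_nonneg (‖w.z - w'.z‖), sq_nonneg (‖w.v - w'.v‖)])).trans h
  rw [pi_norm_le_iff_of_nonneg ((norm_nonneg _).trans h1)]
  exact fun i => (PiLp.norm_apply_le (w.s - w'.s) i).trans h1

theorem norm_v_sub_le (h : w.eucDist w' ≤ r) : ‖w.v.ofLp - w'.v.ofLp‖ ≤ r := by
  have h1 : ‖w.v - w'.v‖ ≤ r :=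
    (Real.le_sqrt_of_sq_le (by
      linarith [sq_nonneg (‖w.x - w'.x‖), sq_nonneg (‖w.y - w'.y‖),
        sq_nonneg (‖w.z - w'.z‖), sq_nonneg (‖w.s - w'.s‖)])).trans h
  rw [pi_norm_le_iff_of_nonneg ((norm_nonneg _).trans h1)]
  exact fun i => (PiLp.norm_apply_le (w.v - w'.v) i).trans h1

theorem dualityMeasure_pos (hmi : 0 < mi) (hs : ∀ i, 0 < w.s i) (hv : ∀ i, 0 < w.v i) :
    0 < w.dualityMeasure := by
  have : Nonempty (Fin mi) := ⟨⟨0, hmi⟩⟩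
  exact div_pos (Finset.sum_pos (fun i _ => mul_pos (hs i) (hv i)) Finset.univ_nonempty)
    (by exact_mod_cast hmi)

theorem mul_le_card_mul_dualityMeasure (hmi : 0 < mi) (hs : ∀ i, 0 < w.s i)
    (hv : ∀ i, 0 < w.v i) (i : Fin mi) : w.s i * w.v i ≤ mi * w.dualityMeasure := by
  have h0 : (0 : ℝ) < mi := by exact_mod_cast hmi
  rw [dualityMeasure, mul_div_cancel₀ _ h0.ne']
  exact Finset.single_le_sum (f := fun i => w.s i * w.v i)
    (fun j _ => (mul_pos (hs j) (hv j)).le) (Finset.mem_univ i)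

/-- By complementarity at `w'`, each product splits as `s v = (s - s') v + s' (v - v')`. -/
theorem dualityMeasure_le (hmi : 0 < mi) (hc : ∀ i, w'.s i * w'.v i = 0)
    (h : w.eucDist w' ≤ r) :
    w.dualityMeasure ≤ r * (‖w.v.ofLp‖ + ‖w'.s.ofLp‖) := by
  have h0 : (0 : ℝ) < mi := by exact_mod_cast hmi
  rw [dualityMeasure, div_le_iff₀ h0]
  calc ∑ i, w.s i * w.v i ≤ ∑ _i : Fin mi, r * (‖w.v.ofLp‖ + ‖w'.s.ofLp‖) := by
        refine Finset.sum_le_sum fun i _ => ?_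
        have e : w.s i * w.v i = (w.s i - w'.s i) * w.v i + w'.s i * (w.v i - w'.v i) := by
          have := hc i
          linear_combination this
        have h1 : |w.s i - w'.s i| ≤ r :=
          (norm_le_pi_norm (w.s.ofLp - w'.s.ofLp) i).trans (norm_s_sub_le h)
        have h2 : |w.v i - w'.v i| ≤ r :=
          (norm_le_pi_norm (w.v.ofLp - w'.v.ofLp) i).trans (norm_v_sub_le h)
        have h3 : |w.v i| ≤ ‖w.v.ofLp‖ := norm_le_pi_norm w.v.ofLp i
        have h4 : |w'.s i| ≤ ‖w'.s.ofLp‖ := norm_le_pi_norm w'.s.ofLp i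
        rw [e, mul_add]
        refine add_le_add ((le_abs_self _).trans ?_) ((le_abs_self _).trans ?_)
        · rw [abs_mul]
          exact mul_le_mul h1 h3 (abs_nonneg _) ((abs_nonneg _).trans h1)
        · rw [abs_mul, mul_comm]
          exact mul_le_mul h2 h4 (abs_nonneg _) ((abs_nonneg _).trans h1)
    _ = r * (‖w.v.ofLp‖ + ‖w'.s.ofLp‖) * mi := by
        rw [Finset.sum_const, Finset.card_univ, Fintype.card_fin, nsmul_eq_mul, mul_comm]

end PDPoint

theorem continuous_jacobianMatrix {m : ℕ}
    {φ : EuclideanSpace ℝ (Fin n) → EuclideanSpace ℝ (Fin m)} (hφ : ContDiff ℝ 2 φ) :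
    Continuous (jacobianMatrix φ) := by
  refine continuous_matrix fun i j => ?_
  have h : Continuous (fderiv ℝ φ) := hφ.continuous_fderiv (by norm_num)
  simp only [jacobianMatrix, Matrix.of_apply]
  fun_prop

namespace NLP

variable {P : NLP n me mi} {wstar : PDPoint n me mi}

theorem exists_norm_sub_le_of_near (hmi : 0 < mi) (hg : ContDiff ℝ 2 P.g)
    (hh : ContDiff ℝ 2 P.h) (hstar : P.IsRegularSolution wstar) {η : ℝ} (hη : 0 < η) :
    ∃ r : ℝ, 0 < r ∧ ∀ w : PDPoint n me mi, w.eucDist wstar ≤ r →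
      ‖P.W w - P.W wstar‖ ≤ η ∧ ‖P.G w - P.G wstar‖ ≤ η ∧ ‖P.H w - P.H wstar‖ ≤ η ∧
      ‖w.v.ofLp - wstar.v.ofLp‖ ≤ η ∧ ‖w.s.ofLp - wstar.s.ofLp‖ ≤ η ∧
      w.dualityMeasure ≤ η := by
  obtain ⟨K, r₁, hr₁, hK⟩ := hstar.lipschitz
  obtain ⟨r₂, hr₂, hG⟩ := Metric.continuous_iff.1 (continuous_jacobianMatrix hg) wstar.x η hη
  obtain ⟨r₃, hr₃, hH⟩ := Metric.continuous_iff.1 (continuous_jacobianMatrix hh) wstar.x η hη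
  set A : ℝ := ‖wstar.v.ofLp‖ + η + ‖wstar.s.ofLp‖ with hA
  have A0 : 0 ≤ A := by positivity
  -- The halves give the strict inequalities of the continuity statements; `|K| + 1` allows any sign
  -- of `K` and avoids a zero denominator.
  set r : ℝ := min (min r₁ (min (r₂ / 2) (r₃ / 2))) (min η (min (η / (|K| + 1)) (η / (A + 1))))
  have r0 : 0 < r := by positivity
  refine ⟨r, r0, fun w hw => ?_⟩
  have h1 : w.eucDist wstar ≤ r₁ := hw.trans ((min_le_left _ _).trans (min_le_left _ _))
  have h2 : r ≤ r₂ / 2 :=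
    (min_le_left _ _).trans ((min_le_right _ _).trans (min_le_left _ _))
  have h3 : r ≤ r₃ / 2 :=
    (min_le_left _ _).trans ((min_le_right _ _).trans (min_le_right _ _))
  have h4 : r ≤ η := (min_le_right _ _).trans (min_le_left _ _)
  have h5 : r ≤ η / (|K| + 1) :=
    (min_le_right _ _).trans ((min_le_right _ _).trans (min_le_left _ _))
  have h6 : r ≤ η / (A + 1) :=
    (min_le_right _ _).trans ((min_le_right _ _).trans (min_le_right _ _))
  have hx := PDPoint.norm_x_sub_le hw
  have hv := (PDPoint.norm_v_sub_le hw).trans h4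
  refine ⟨?_, ?_, ?_, hv, (PDPoint.norm_s_sub_le hw).trans h4, ?_⟩
  · refine (hK w wstar h1 (by simp [PDPoint.eucDist, hr₁.le])).trans ?_
    have d0 : 0 ≤ w.eucDist wstar := Real.sqrt_nonneg _
    calc K * w.eucDist wstar ≤ (|K| + 1) * r :=
          mul_le_mul ((le_abs_self K).trans (by linarith)) hw d0 (by positivity)
      _ ≤ (|K| + 1) * (η / (|K| + 1)) := by gcongr
      _ = η := by field_simp
  · rw [← dist_eq_norm]
    exact (hG w.x (by rw [dist_eq_norm]; linarith)).le
  · rw [← dist_eq_norm]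
    exact (hH w.x (by rw [dist_eq_norm]; linarith)).le
  · refine (PDPoint.dualityMeasure_le hmi hstar.kkt.compl hw).trans ?_
    have h7 : ‖w.v.ofLp‖ ≤ ‖wstar.v.ofLp‖ + η := by
      have := norm_le_norm_add_norm_sub' w.v.ofLp wstar.v.ofLp
      linarith
    calc r * (‖w.v.ofLp‖ + ‖wstar.s.ofLp‖) ≤ η / (A + 1) * (A + 1) := by
          refine mul_le_mul h6 ?_ (by positivity) (by positivity)
          linarith
      _ = η := by field_simp

theorem v_pos_of_active (hstar : P.IsRegularSolution wstar) {i : Fin mi}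
    (hi : i ∈ P.activeSet wstar.x) : 0 < wstar.v i := by
  have h := hstar.strict_compl i hi
  have h2 := congrArg (fun y : EuclideanSpace ℝ (Fin mi) => y i) hstar.kkt.stationary_s
  simp only [PiLp.sub_apply, PiLp.zero_apply] at h2
  linarith

theorem s_eq_neg_h (hstar : P.IsRegularSolution wstar) (i : Fin mi) :
    wstar.s i = -P.h wstar.x i := by
  have h2 := congrArg (fun y : EuclideanSpace ℝ (Fin mi) => y i) hstar.kkt.feasible_h
  simp only [PiLp.add_apply, PiLp.zero_apply] at h2
  linarith

/-- The limiting primal-dual system at a regular solution is nonsingular. -/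
theorem saddleMap_injective_of_regular (hstar : P.IsRegularSolution wstar) :
    Function.Injective (saddleMap (P.W wstar, P.G wstar, P.H wstar, (1 : Fin me → ℝ), (0 : ℝ),
      wstar.v.ofLp, wstar.s.ofLp)) := by
  rw [← LinearMap.ker_eq_bot, LinearMap.ker_eq_bot']
  rintro ⟨x, μ, ν⟩ h
  rw [saddleMap_apply, Prod.mk_eq_zero, Prod.mk_eq_zero] at h
  obtain ⟨h1, h2, h3⟩ := h
  rw [one_mul, zero_smul, sub_zero] at h2
  have hact : ∀ i ∈ P.activeSet wstar.x, (P.H wstar *ᵥ x) i = 0 := by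
    intro i hi
    have h4 := congrFun h3 i
    have h5 : wstar.s i = 0 := by
      rw [s_eq_neg_h hstar, neg_eq_zero]; exact hi
    simpa [h5, (v_pos_of_active hstar hi).ne'] using h4
  have hinact : ∀ i ∉ P.activeSet wstar.x, ν i = 0 := by
    intro i hi
    have h4 := congrFun h3 i
    have h5 : wstar.s i ≠ 0 := by
      rw [s_eq_neg_h hstar, neg_ne_zero]; exact hi
    have h6 : wstar.v i = 0 := (mul_eq_zero.1 (hstar.kkt.compl i)).resolve_left h5
    simpa [h6, h5] using h4
  -- Pairing the first row with `x` kills both multiplier terms, because `G x = 0` and `ν`, `H x`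
  -- have disjoint supports; what remains is `xᵀ W x = 0`.
  have hx : x = 0 := by
    by_contra hx
    refine (hstar.sosc x hx ?_).ne' ?_
    · rw [activeJacobian, Matrix.fromRows_mulVec, h2]
      ext (i | i)
      · rfl
      · exact hact i i.2
    · have h4 := congrArg (x ⬝ᵥ ·) h1
      simp only [dotProduct_add, dotProduct_zero, Matrix.mulVec_transpose] at h4
      rw [dotProduct_comm x (μ ᵥ* _), ← Matrix.dotProduct_mulVec, h2, dotProduct_zero,
        dotProduct_comm x (ν ᵥ* _), ← Matrix.dotProduct_mulVec] at h4
      have h5 : ν ⬝ᵥ P.H wstar *ᵥ x = 0 := by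
        refine Finset.sum_eq_zero fun i _ => ?_
        by_cases hi : i ∈ P.activeSet wstar.x
        · rw [hact i hi, mul_zero]
        · rw [hinact i hi, zero_mul]
      simpa [h5] using h4
  subst hx
  simp only [Matrix.mulVec_zero, zero_add, Matrix.mulVec_transpose] at h1
  classical
  have := Fintype.ofFinite (P.activeSet wstar.x)
  -- With `x = 0`, the first row is a linear relation among the rows of the active Jacobian, which
  -- LICQ makes trivial.
  have hli := Matrix.vecMul_injective_iff.2 hstar.licq
  have h0 : Sum.elim μ (fun i : P.activeSet wstar.x => ν i) = 0 := by
    refine hli ?_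
    have h6 : (fun i : P.activeSet wstar.x => ν i) ᵥ* (P.H wstar).submatrix (fun i => i.1) id
        = ν ᵥ* P.H wstar := by
      ext j
      simp only [Matrix.vecMul, dotProduct, Matrix.submatrix_apply, id]
      rw [← Finset.sum_subtype (P.activeSet wstar.x).toFinset (fun i => Set.mem_toFinset)
        (fun i => ν i * P.H wstar i j)]
      refine Finset.sum_subset (Finset.subset_univ _) fun i _ hi => ?_
      rw [hinact i (by rwa [Set.mem_toFinset] at hi), zero_mul]
    show _ ᵥ* activeJacobian P wstar = 0 ᵥ* activeJacobian P wstar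
    rw [activeJacobian, Matrix.sumElim_vecMul_fromRows, h6, h1, Matrix.zero_vecMul]
  refine Prod.mk_eq_zero.2 ⟨rfl, Prod.mk_eq_zero.2 ⟨?_, ?_⟩⟩
  · ext j
    exact congrFun h0 (Sum.inl j)
  · ext i
    by_cases hi : i ∈ P.activeSet wstar.x
    · exact congrFun h0 (Sum.inr ⟨i, hi⟩)
    · exact hinact i hi

end NLP

end PrimalDualPoints

/-! ### Size of the exact data and of the rounding errors -/

section FloatingPoint

variable {n me mi : ℕ}

theorem isUnit_det_of_mulVec_eq_zero {A : Matrix (Fin n) (Fin n) ℝ}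
    (h : ∀ x, A *ᵥ x = 0 → x = 0) : IsUnit A.det := by
  rw [← Matrix.isUnit_iff_isUnit_det, ← Matrix.mulVec_injective_iff_isUnit]
  exact (injective_iff_map_eq_zero A.mulVecLin).2 h

/-- The condensed matrix is invertible where its primal-dual system is uniformly nonsingular. -/
theorem isUnit_det_condensed {W : Matrix (Fin n) (Fin n) ℝ} {G : Matrix (Fin me) (Fin n) ℝ}
    {H : Matrix (Fin mi) (Fin n) ℝ} {D s : Fin mi → ℝ} {Γ : Fin me → ℝ} {ω c : ℝ}
    (h : ∀ z, ‖z‖ ≤ c * ‖saddleMap (W, G, H, ω • Γ, ω, s * D, s) z‖) :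
    IsUnit (W + Hᵀ * Matrix.diagonal D * H + Gᵀ * Matrix.diagonal Γ * G).det := by
  refine isUnit_det_of_mulVec_eq_zero fun x hx => ?_
  have h1 := saddleMap_condensed W G H D s Γ ω x 0 (by rw [hx, Matrix.mulVec_zero])
  have h2 := h (x, Γ * (G *ᵥ x) - 0, D * (H *ᵥ x))
  rw [h1, smul_zero] at h2
  have h3 : ‖((0 : Fin n → ℝ), (0 : Fin me → ℝ), (0 : Fin mi → ℝ))‖ = 0 := norm_zero
  rw [h3, mul_zero] at h2
  exact congrArg Prod.fst (norm_le_zero_iff.1 h2)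

/-- The right-hand sides `Gᵀ e` of the condensed systems lead to solutions of size `O(ω)`, whose
images under `G` depend on the data in a Lipschitz way. -/
theorem norm_mulVec_condensed_sub_le {W W' : Matrix (Fin n) (Fin n) ℝ}
    {G G' : Matrix (Fin me) (Fin n) ℝ} {H H' : Matrix (Fin mi) (Fin n) ℝ} {D D' s : Fin mi → ℝ}
    {Γ Γ' : Fin me → ℝ} {ω c τ ρ : ℝ} {x y : Fin n → ℝ} {e : Fin me → ℝ} (hc : 0 ≤ c)
    (hτ : 0 ≤ τ) (hρ : 0 ≤ ρ)
    (hstab : ∀ z, ‖z‖ ≤ c * ‖saddleMap (W', G', H', ω • Γ', ω, s * D', s) z‖)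
    (hpert : ∀ z z', saddleMap (W, G, H, ω • Γ, ω, s * D, s) z
        = saddleMap (W', G', H', ω • Γ', ω, s * D', s) z' →
      ‖z' - z‖ ≤ c * ρ * ‖saddleMap (W', G', H', ω • Γ', ω, s * D', s) z'‖)
    (hω : ‖ω • e‖ ≤ τ)
    (hx : (W + Hᵀ * Matrix.diagonal D * H + Gᵀ * Matrix.diagonal Γ * G) *ᵥ x = Gᵀ *ᵥ e)
    (hy : (W' + H'ᵀ * Matrix.diagonal D' * H' + G'ᵀ * Matrix.diagonal Γ' * G') *ᵥ y
      = G'ᵀ *ᵥ e) :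
    ‖G' *ᵥ y - G *ᵥ x‖ ≤ n * ‖G' - G‖ * (c * τ) + n * ‖G‖ * (c * ρ * τ) := by
  have zx := saddleMap_condensed W G H D s Γ ω x e hx
  have zy := saddleMap_condensed W' G' H' D' s Γ' ω y e hy
  have hrhs : ‖((0 : Fin n → ℝ), ω • e, (0 : Fin mi → ℝ))‖ ≤ τ := by
    simp only [norm_prod_le_iff, norm_zero]
    exact ⟨hτ, hω, hτ⟩
  have hyb : ‖y‖ ≤ c * τ := by
    have h1 := hstab (y, Γ' * (G' *ᵥ y) - e, D' * (H' *ᵥ y))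
    rw [zy] at h1
    exact ((norm_fst_le _).trans h1).trans (by gcongr)
  have hyx : ‖y - x‖ ≤ c * ρ * τ := by
    have h1 := hpert _ _ (zx.trans zy.symm)
    rw [zy] at h1
    exact ((norm_fst_le _).trans h1).trans (by gcongr)
  -- The error in `G` meets the small solution `y`; the exact `G` meets the change of solution.
  have h1 : G' *ᵥ y - G *ᵥ x = (G' - G) *ᵥ y + G *ᵥ (y - x) := by
    rw [Matrix.sub_mulVec, Matrix.mulVec_sub]; abel
  have h2 := norm_mulVec_le_card_mul (G' - G) y
  have h3 := norm_mulVec_le_card_mul G (y - x)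
  rw [Fintype.card_fin] at h2 h3
  rw [h1]
  exact ((norm_add_le _ _).trans (add_le_add h2 h3)).trans (by gcongr)

namespace NLP

variable {P : NLP n me mi} {w : PDPoint n me mi} {γ : ℝ}

theorem K_eq_condensed : P.K γ w = P.W w
    + (P.H w)ᵀ * Matrix.diagonal (fun i => (w.s i)⁻¹ * w.v i) * P.H w
    + (P.G w)ᵀ * Matrix.diagonal (fun _ : Fin me => γ) * P.G w := by
  rw [K, ← Matrix.smul_one_eq_diagonal, Matrix.mul_smul, Matrix.mul_one, Matrix.smul_mul]

/-- The factor 2 leaves room for `v₀ ≤ v i` at nearby points. -/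
theorem exists_lower_bound_active (hstar : P.IsRegularSolution w) :
    ∃ v₀ : ℝ, 0 < v₀ ∧ ∀ i ∈ P.activeSet w.x, 2 * v₀ ≤ w.v i := by
  rcases isEmpty_or_nonempty (P.activeSet w.x) with hB | hB
  · exact ⟨1, one_pos, fun i hi => (hB.false ⟨i, hi⟩).elim⟩
  · obtain ⟨i, hi⟩ := Finite.exists_min (fun i : P.activeSet w.x => w.v i)
    exact ⟨w.v i / 2, half_pos (v_pos_of_active hstar i.2), fun j hj => by
      have := hi ⟨j, hj⟩
      dsimp only at this
      linarith⟩

/-- For exact weights the scalings cancel: `γ⁻¹ γ = 1` and `s s⁻¹ v = v`. -/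
theorem norm_saddleData_sub_limit_le {wstar : PDPoint n me mi} {η : ℝ} (hs : ∀ i, 0 < w.s i)
    (hγ : 0 < γ) (hω : γ⁻¹ ≤ η) (dW : ‖P.W w - P.W wstar‖ ≤ η)
    (dG : ‖P.G w - P.G wstar‖ ≤ η) (dH : ‖P.H w - P.H wstar‖ ≤ η)
    (dv : ‖w.v.ofLp - wstar.v.ofLp‖ ≤ η) (ds : ‖w.s.ofLp - wstar.s.ofLp‖ ≤ η) :
    ‖((P.W w, P.G w, P.H w, γ⁻¹ • (fun _ => γ), γ⁻¹,
        w.s.ofLp * (fun i => (w.s i)⁻¹ * w.v i), w.s.ofLp) :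
        SaddleData (Fin n) (Fin me) (Fin mi))
      - (P.W wstar, P.G wstar, P.H wstar, 1, 0, wstar.v.ofLp, wstar.s.ofLp)‖ ≤ η := by
  have e1 : (γ⁻¹ • (fun _ => γ) : Fin me → ℝ) = 1 := by
    ext j; simp [hγ.ne']
  have e2 : (w.s.ofLp * (fun i => (w.s i)⁻¹ * w.v i)) = w.v.ofLp := by
    ext i; simp [(hs i).ne']
  rw [e1, e2]
  simp only [Prod.mk_sub_mk, norm_prod_le_iff, sub_self, norm_zero, sub_zero]
  refine ⟨dW, dG, dH, (norm_nonneg _).trans dv, ?_, dv, ds⟩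
  rwa [norm_inv, Real.norm_of_nonneg hγ.le]

/-- Centrality keeps `s i * v i` above `αΞ`, so bounded multipliers force slacks of order at least
`Ξ`. -/
theorem inv_le_of_central {C α R : ℝ} (hα : 0 < α) (hmi : 0 < mi) (hw : P.IsCentral C α w)
    (hv : ‖w.v.ofLp‖ ≤ R) (i : Fin mi) : (w.s i)⁻¹ ≤ R / (α * w.dualityMeasure) := by
  have ht := PDPoint.dualityMeasure_pos hmi hw.s_pos hw.v_pos
  have h1 : w.v i ≤ R := (le_abs_self _).trans ((norm_le_pi_norm w.v.ofLp i).trans hv)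
  have hs := hw.s_pos i
  rw [inv_eq_one_div, div_le_div_iff₀ hs (by positivity), one_mul]
  exact (hw.compl_ge i).trans (by rw [mul_comm]; gcongr)

theorem sigmaBar_le {C α R b : ℝ} (hα : 0 < α) (hmi : 0 < mi) (hw : P.IsCentral C α w)
    (hR : 0 ≤ R) (hb : 0 ≤ b) (hv : ‖w.v.ofLp‖ ≤ R) (hγ : γ ≤ b * (w.dualityMeasure)⁻¹)
    (B : Set (Fin mi)) : sigmaBar γ B w ≤ (R / α + b) / w.dualityMeasure := by
  have ht := PDPoint.dualityMeasure_pos hmi hw.s_pos hw.v_pos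
  have h0 : 0 ≤ R / α / w.dualityMeasure := by positivity
  have h1 : 0 ≤ b / w.dualityMeasure := by positivity
  rw [add_div]
  refine max_le ?_ ?_
  · rcases isEmpty_or_nonempty B with hB | hB
    -- Without active constraints the infimum is `0` by default and `1 / 0 = 0`.
    · rw [Real.iInf_of_isEmpty, div_zero]
      exact add_nonneg h0 h1
    · obtain ⟨i, hi⟩ := exists_eq_ciInf_of_finite (f := fun i : B => w.s i)
      rw [← hi, one_div]
      have := inv_le_of_central hα hmi hw hv i.1
      rw [← div_div] at this
      linarith
  · rw [← div_eq_mul_inv] at hγ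
    linarith

theorem norm_K_le {C α R b : ℝ} (hα : 0 < α) (hmi : 0 < mi) (hw : P.IsCentral C α w)
    (hR : 0 ≤ R) (hv : ‖w.v.ofLp‖ ≤ R) (hγ0 : 0 ≤ γ) (hγ : γ ≤ b * (w.dualityMeasure)⁻¹)
    (hW : ‖P.W w‖ ≤ R) (hG : ‖P.G w‖ ≤ R) (hH : ‖P.H w‖ ≤ R) (ht1 : w.dualityMeasure ≤ 1) :
    ‖P.K γ w‖ ≤ (R + R * (R / α * R) * R + b * (R * R)) / w.dualityMeasure := by
  have ht := PDPoint.dualityMeasure_pos hmi hw.s_pos hw.v_pos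
  have hD : ‖fun i => (w.s i)⁻¹ * w.v i‖ ≤ R / (α * w.dualityMeasure) * R := by
    rw [pi_norm_le_iff_of_nonneg (by positivity)]
    intro i
    have hs := hw.s_pos i
    rw [norm_mul, norm_inv, Real.norm_of_nonneg hs.le]
    exact mul_le_mul (inv_le_of_central hα hmi hw hv i)
      ((norm_le_pi_norm w.v.ofLp i).trans hv) (norm_nonneg _) (by positivity)
  have h1 : ‖(P.H w)ᵀ * Matrix.diagonal (fun i => (w.s i)⁻¹ * w.v i) * P.H w‖
      ≤ R * (R / (α * w.dualityMeasure) * R) * R := by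
    refine (Matrix.l2_opNorm_mul _ _).trans (mul_le_mul ((Matrix.l2_opNorm_mul _ _).trans ?_) hH
      (norm_nonneg _) (by positivity))
    rw [norm_transpose_l2, Matrix.l2_opNorm_diagonal]
    exact mul_le_mul hH hD (norm_nonneg _) hR
  have h2 : ‖γ • ((P.G w)ᵀ * P.G w)‖ ≤ b * (w.dualityMeasure)⁻¹ * (R * R) := by
    rw [norm_smul, Real.norm_of_nonneg hγ0]
    refine mul_le_mul hγ ((Matrix.l2_opNorm_mul _ _).trans ?_) (norm_nonneg _) (hγ0.trans hγ)
    rw [norm_transpose_l2]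
    exact mul_le_mul hG hG (norm_nonneg _) hR
  have h3 : R ≤ R / w.dualityMeasure := le_div_self hR ht ht1
  calc ‖P.K γ w‖ ≤ R / w.dualityMeasure + R * (R / (α * w.dualityMeasure) * R) * R
        + b * (w.dualityMeasure)⁻¹ * (R * R) :=
        (norm_add₃_le).trans (add_le_add (add_le_add (hW.trans h3) h1) h2)
    _ = _ := by field_simp

end NLP

namespace FloatData

variable {P : NLP n me mi} {w : PDPoint n me mi} {γ : ℝ} {F : FloatData n me mi}

/-- The relative distance, in units of `u / Ξ`, of the computed primal-dual data to the exact. -/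
theorem norm_saddleData_sub_le {B : Set (Fin mi)} {C α R a c ε u Kb σb v₀ : ℝ}
    (hmi : 0 < mi) (hw : P.IsCentral C α w) (ha : 0 < a) (hc : 0 ≤ c) (hε : 0 ≤ ε) (hu : 0 < u)
    (hv₀ : 0 < v₀) (hKb : 0 ≤ Kb) (hσb : 0 ≤ σb) (hR : 0 ≤ R)
    (ht1 : w.dualityMeasure ≤ 1) (hγ : a * (w.dualityMeasure)⁻¹ ≤ γ)
    (hF : F.IsRounding P B c u γ w) {E : Matrix (Fin n) (Fin n) ℝ}
    (hE : IsBackwardError ε u (P.K γ w) E) (hK : ‖P.K γ w‖ ≤ Kb / w.dualityMeasure)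
    (hσ : NLP.sigmaBar γ B w ≤ σb / w.dualityMeasure) (hs : ‖w.s.ofLp‖ ≤ R)
    (hv : ∀ i ∈ B, v₀ ≤ w.v i) :
    ‖((F.W + E, F.G, F.H, γ⁻¹ • F.Γ, γ⁻¹, w.s.ofLp * F.Ds, w.s.ofLp) :
        SaddleData (Fin n) (Fin me) (Fin mi))
      - (P.W w, P.G w, P.H w, γ⁻¹ • (fun _ => γ), γ⁻¹,
        w.s.ofLp * (fun i => (w.s i)⁻¹ * w.v i), w.s.ofLp)‖
      ≤ (c + ε * Kb + c * σb / a + mi * c * σb / v₀ + R * c) * (u / w.dualityMeasure) := by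
  have ht := PDPoint.dualityMeasure_pos hmi hw.s_pos hw.v_pos
  set t := w.dualityMeasure with htdef
  have hγ0 : 0 < γ := lt_of_lt_of_le (by positivity) hγ
  have hinv : γ⁻¹ ≤ t / a := by
    rw [inv_le_comm₀ hγ0 (by positivity), inv_div]
    rwa [div_eq_mul_inv]
  have q0 : 0 ≤ u / t := by positivity
  have hut : u ≤ u / t := le_div_self hu.le ht ht1
  have k1 : 0 ≤ c * (u / t) := by positivity
  have k2 : 0 ≤ ε * Kb * (u / t) := by positivity
  have k3 : 0 ≤ c * σb / a * (u / t) := by positivity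
  have k4 : 0 ≤ mi * c * σb / v₀ * (u / t) := by positivity
  have k5 : 0 ≤ R * c * (u / t) := by positivity
  have hcu : c * u ≤ c * (u / t) := by gcongr
  rw [add_mul, add_mul, add_mul, add_mul]
  simp only [Prod.mk_sub_mk, norm_prod_le_iff, sub_self, norm_zero]
  refine ⟨?_, ?_, ?_, ?_, by positivity, ?_, by positivity⟩
  · have h1 : F.W + E - P.W w = (F.W - P.W w) + E := by abel
    have h2 : ‖E‖ ≤ ε * Kb * (u / t) := by
      refine hE.2.trans ?_
      calc u * ε * ‖P.K γ w‖ ≤ u * ε * (Kb / t) := by gcongr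
        _ = _ := by ring
    rw [h1]
    have h3 := norm_add_le (F.W - P.W w) E
    have h4 := hF.W_err
    linarith
  · have := hF.G_err
    linarith
  · have := hF.H_err
    linarith
  · rw [← smul_sub, norm_smul, norm_inv, Real.norm_of_nonneg hγ0.le]
    have h1 : ‖F.Γ - fun _ => γ‖ ≤ c * u * (σb / t) := by
      rw [pi_norm_le_iff_of_nonneg (by positivity)]
      exact fun j => (hF.Γ_err j).trans (by gcongr)
    have h2 : γ⁻¹ * ‖F.Γ - fun _ => γ‖ ≤ t / a * (c * u * (σb / t)) := by gcongr
    have h3 : t / a * (c * u * (σb / t)) = t * (c * σb / a * (u / t)) := by ring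
    have h4 : t * (c * σb / a * (u / t)) ≤ c * σb / a * (u / t) := mul_le_of_le_one_left k3 ht1
    linarith
  · rw [pi_norm_le_iff_of_nonneg (by positivity)]
    intro i
    have hsi := hw.s_pos i
    have h1 : (w.s.ofLp * F.Ds - w.s.ofLp * fun i => (w.s i)⁻¹ * w.v i) i
        = w.s i * (F.Ds i - (w.s i)⁻¹ * w.v i) := by
      simp [mul_sub]
    rw [h1, norm_mul, Real.norm_of_nonneg hsi.le]
    -- An active slack is `O(Ξ)`, which compensates `σ̄ = O(1/Ξ)`; an inactive slack is only
    -- bounded, but its weight has error `O(uΞ)`.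
    by_cases hi : i ∈ B
    · have h2 : w.s i ≤ mi * t / v₀ := by
        rw [le_div_iff₀ hv₀]
        exact (mul_le_mul_of_nonneg_left (hv i hi) hsi.le).trans
          (PDPoint.mul_le_card_mul_dualityMeasure hmi hw.s_pos hw.v_pos i)
      have h3 : ‖F.Ds i - (w.s i)⁻¹ * w.v i‖ ≤ c * u * (σb / t) :=
        (hF.Ds_active_err i hi).trans (by gcongr)
      have h4 := mul_le_mul h2 h3 (norm_nonneg _) (by positivity)
      have h5 : mi * t / v₀ * (c * u * (σb / t)) = t * (mi * c * σb / v₀ * (u / t)) := by ring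
      have h6 := mul_le_of_le_one_left k4 ht1
      linarith
    · have h2 : w.s i ≤ R := (le_abs_self _).trans ((norm_le_pi_norm w.s.ofLp i).trans hs)
      have h3 : ‖F.Ds i - (w.s i)⁻¹ * w.v i‖ ≤ c * (u / t) := by
        refine (hF.Ds_inactive_err i hi).trans (le_trans ?_ hcu)
        exact mul_le_of_le_one_right (by positivity) ht1
      have h4 := mul_le_mul h2 h3 (norm_nonneg _) hR
      linarith

end FloatData

end FloatingPoint

/-! ### The error bound for the Schur complement -/

theorem mainTheorem5 {n me mi : ℕ} (hmi : 0 < mi) (P : NLP n me mi)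
    (hf : ContDiff ℝ 2 P.f) (hg : ContDiff ℝ 2 P.g) (hh : ContDiff ℝ 2 P.h)
    (wstar : PDPoint n me mi) (hstar : P.IsRegularSolution wstar)
    (C α : ℝ) (hC : 0 < C) (hα : α ∈ Set.Ioo (0 : ℝ) 1)
    (a b : ℝ) (ha : 0 < a) (hab : a ≤ b)
    (c ε : ℝ) (hc : 0 ≤ c) (hε : 0 ≤ ε) :
    ∃ M r κ : ℝ, 0 < M ∧ 0 < r ∧ 0 < κ ∧
      ∀ (w : PDPoint n me mi) (γ u : ℝ) (F : FloatData n me mi)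
        (E : Fin me → Matrix (Fin n) (Fin n) ℝ),
        w.eucDist wstar ≤ r →
        P.IsCentral C α w →
        a * (w.dualityMeasure)⁻¹ ≤ γ → γ ≤ b * (w.dualityMeasure)⁻¹ →
        0 < u → u ≤ κ * w.dualityMeasure →
        F.IsRounding P (P.activeSet wstar.x) c u γ w →
        (∀ j, IsBackwardError ε u (P.K γ w) (E j)) →
        IsUnit (P.K γ w).det ∧ (∀ j, IsUnit (F.K + E j).det) ∧
          ‖F.S E - P.S γ w‖ ≤ M * u := by
  have hα0 : 0 < α := hα.1
  have hb : 0 < b := ha.trans_le hab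
  obtain ⟨c₁, δ, hc₁, hδ, hstab, hpert⟩ :=
    exists_saddleMap_stability _ (NLP.saddleMap_injective_of_regular hstar)
  obtain ⟨c₂, hc₂, hentry⟩ := exists_l2_opNorm_le_of_entries (Fin me) (Fin me)
  obtain ⟨v₀, hv₀, hv₀B⟩ := NLP.exists_lower_bound_active hstar
  -- `1` bounds `Ξ` and all norms by `R`; `v₀` keeps active multipliers away from zero; `δ / 2`
  -- spends half the stability radius on the exact data, and `δ / 2 * a` does so for `γ⁻¹ ≤ Ξ / a`.
  obtain ⟨η, hηdef⟩ : ∃ z : ℝ, z = min (min 1 v₀) (min (δ / 2) (δ / 2 * a)) := ⟨_, rfl⟩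
  have hη : 0 < η := by rw [hηdef]; positivity
  obtain ⟨r, hr, hnear⟩ := NLP.exists_norm_sub_le_of_near hmi hg hh hstar hη
  obtain ⟨R, hRdef⟩ : ∃ z : ℝ, z = ‖P.W wstar‖ + ‖P.G wstar‖ + ‖P.H wstar‖ + ‖wstar.v.ofLp‖
      + ‖wstar.s.ofLp‖ + 1 := ⟨_, rfl⟩
  have hR : 0 ≤ R := by rw [hRdef]; positivity
  obtain ⟨Kb, hKb⟩ : ∃ z : ℝ, z = R + R * (R / α * R) * R + b * (R * R) := ⟨_, rfl⟩
  obtain ⟨σb, hσb⟩ : ∃ z : ℝ, z = R / α + b := ⟨_, rfl⟩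
  obtain ⟨M₁, hM₁⟩ : ∃ z : ℝ, z = c + ε * Kb + c * σb / a + mi * c * σb / v₀ + R * c := ⟨_, rfl⟩
  have hKb0 : 0 ≤ Kb := by rw [hKb]; positivity
  have hσb0 : 0 ≤ σb := by rw [hσb]; positivity
  have hM₁0 : 0 ≤ M₁ := by rw [hM₁]; positivity
  obtain ⟨M, hM⟩ : ∃ z : ℝ, z = c₂ * (n * (c * (c₁ / a) + R * (c₁ * M₁ / a))) + 1 := ⟨_, rfl⟩
  have hM0 : 0 < M := by rw [hM]; positivity
  -- This `κ` keeps the data error `M₁ u / Ξ` within the other half of `δ`; `M₁` itself may vanish.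
  refine ⟨M, r, δ / 2 / (M₁ + 1), hM0, hr, by positivity, ?_⟩
  intro w γ u F E hwr hw hγa hγb hu huκ hF hE
  obtain ⟨dW, dG, dH, dv, ds, dt⟩ := hnear w hwr
  have ht := PDPoint.dualityMeasure_pos hmi hw.s_pos hw.v_pos
  generalize htdef : w.dualityMeasure = t at *
  have η1 : η ≤ 1 := hηdef.trans_le <| (min_le_left _ _).trans (min_le_left _ _)
  have ηv : η ≤ v₀ := hηdef.trans_le <| (min_le_left _ _).trans (min_le_right _ _)
  have ηδ : η ≤ δ / 2 := hηdef.trans_le <| (min_le_right _ _).trans (min_le_left _ _)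
  have ηa : η ≤ δ / 2 * a := hηdef.trans_le <| (min_le_right _ _).trans (min_le_right _ _)
  have ht1 : t ≤ 1 := dt.trans η1
  have hγ0 : 0 < γ := lt_of_lt_of_le (by positivity) hγa
  have hinv : γ⁻¹ ≤ t / a := by
    rw [inv_le_comm₀ hγ0 (by positivity), inv_div]
    rwa [div_eq_mul_inv]
  have nW := norm_nonneg (P.W wstar)
  have nG := norm_nonneg (P.G wstar)
  have nH := norm_nonneg (P.H wstar)
  have nv := norm_nonneg wstar.v.ofLp
  have ns := norm_nonneg wstar.s.ofLp
  have bW : ‖P.W w‖ ≤ R := by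
    have := norm_le_norm_add_norm_sub' (P.W w) (P.W wstar)
    linarith
  have bG : ‖P.G w‖ ≤ R := by
    have := norm_le_norm_add_norm_sub' (P.G w) (P.G wstar)
    linarith
  have bH : ‖P.H w‖ ≤ R := by
    have := norm_le_norm_add_norm_sub' (P.H w) (P.H wstar)
    linarith
  have bv : ‖w.v.ofLp‖ ≤ R := by
    have := norm_le_norm_add_norm_sub' w.v.ofLp wstar.v.ofLp
    linarith
  have bs : ‖w.s.ofLp‖ ≤ R := by
    have := norm_le_norm_add_norm_sub' w.s.ofLp wstar.s.ofLp
    linarith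
  have hvB : ∀ i ∈ P.activeSet wstar.x, v₀ ≤ w.v i := fun i hi => by
    have h1 : |w.v i - wstar.v i| ≤ η := (norm_le_pi_norm (w.v.ofLp - wstar.v.ofLp) i).trans dv
    have h2 := hv₀B i hi
    have h3 := (abs_le.1 h1).1
    linarith
  have hut : M₁ * (u / t) ≤ δ / 2 := by
    have h1 : u / t ≤ δ / 2 / (M₁ + 1) := by rwa [div_le_iff₀ ht]
    calc M₁ * (u / t) ≤ (M₁ + 1) * (δ / 2 / (M₁ + 1)) := by
          gcongr
          exact le_add_of_nonneg_right zero_le_one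
      _ = δ / 2 := by field_simp
  have hM' : c₂ * (n * (c * (c₁ / a) + R * (c₁ * M₁ / a)) * u) ≤ M * u := by
    rw [hM, add_mul, one_mul, mul_assoc c₂]
    exact le_add_of_nonneg_right hu.le
  set p : SaddleData (Fin n) (Fin me) (Fin mi) := (P.W w, P.G w, P.H w, γ⁻¹ • (fun _ => γ), γ⁻¹,
    w.s.ofLp * (fun i => (w.s i)⁻¹ * w.v i), w.s.ofLp)
  set q : Fin me → SaddleData (Fin n) (Fin me) (Fin mi) := fun j =>
    (F.W + E j, F.G, F.H, γ⁻¹ • F.Γ, γ⁻¹, w.s.ofLp * F.Ds, w.s.ofLp)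
  have bK : ‖P.K γ w‖ ≤ Kb / t := by
    have := NLP.norm_K_le hα0 hmi hw hR bv hγ0.le (htdef ▸ hγb) bW bG bH (htdef ▸ ht1)
    rwa [← hKb, htdef] at this
  have bσ : NLP.sigmaBar γ (P.activeSet wstar.x) w ≤ σb / t := by
    have := NLP.sigmaBar_le hα0 hmi hw hR hb.le bv (htdef ▸ hγb) (P.activeSet wstar.x)
    rwa [← hσb, htdef] at this
  have hpq : ∀ j, ‖q j - p‖ ≤ M₁ * (u / t) := fun j => by
    rw [hM₁]
    subst htdef
    exact FloatData.norm_saddleData_sub_le hmi hw ha hc hε hu hv₀ hKb0 hσb0 hR ht1 hγa hF (hE j)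
      bK bσ bs hvB
  have hp0 := show ‖p - (P.W wstar, P.G wstar, P.H wstar, (1 : Fin me → ℝ), (0 : ℝ),
      wstar.v.ofLp, wstar.s.ofLp)‖ ≤ δ / 2 by
    refine NLP.norm_saddleData_sub_limit_le hw.s_pos hγ0 (hinv.trans ?_) (dW.trans ηδ)
      (dG.trans ηδ) (dH.trans ηδ) (dv.trans ηδ) (ds.trans ηδ)
    rw [div_le_iff₀ ha]
    exact dt.trans ηa
  have hq0 := fun j => show ‖q j - (P.W wstar, P.G wstar, P.H wstar, (1 : Fin me → ℝ), (0 : ℝ),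
      wstar.v.ofLp, wstar.s.ofLp)‖ ≤ δ from
    (norm_sub_le_norm_sub_add_norm_sub _ p _).trans
      ((add_le_add ((hpq j).trans hut) hp0).trans_eq (add_halves δ))
  replace hp0 := hp0.trans (half_le_self hδ.le)
  have eK := NLP.K_eq_condensed (P := P) (w := w) (γ := γ)
  have eF : ∀ j, F.K + E j = (F.W + E j) + F.Hᵀ * Matrix.diagonal F.Ds * F.H
      + F.Gᵀ * Matrix.diagonal F.Γ * F.G := fun j => by rw [FloatData.K]; abel
  have uK : IsUnit (P.K γ w).det := by
    rw [eK]; exact isUnit_det_condensed (hstab p hp0)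
  have uF : ∀ j, IsUnit (F.K + E j).det := fun j => by
    rw [eF]; exact isUnit_det_condensed (hstab (q j) (hq0 j))
  refine ⟨uK, uF, ?_⟩
  refine (hentry _ _ fun i j => ?_).trans hM'
  set e : Fin me → ℝ := Pi.single j 1
  set x := (P.K γ w)⁻¹ *ᵥ (P.G w)ᵀ.col j
  set y := (F.K + E j)⁻¹ *ᵥ F.Gᵀ.col j
  have hx : P.K γ w *ᵥ x = (P.G w)ᵀ *ᵥ e := by
    rw [Matrix.mulVec_mulVec, Matrix.mul_nonsing_inv _ uK, Matrix.one_mulVec,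
      Matrix.mulVec_single_one]
  have hy : (F.K + E j) *ᵥ y = F.Gᵀ *ᵥ e := by
    rw [Matrix.mulVec_mulVec, Matrix.mul_nonsing_inv _ (uF j), Matrix.one_mulVec,
      Matrix.mulVec_single_one]
  rw [eK] at hx
  rw [eF] at hy
  have hω : ‖γ⁻¹ • e‖ ≤ t / a := by
    rw [norm_smul, norm_inv, Real.norm_of_nonneg hγ0.le, Pi.norm_single, norm_one, mul_one]
    exact hinv
  have hS : (F.S E - P.S γ w) i j = (F.G *ᵥ y - P.G w *ᵥ x) i := by
    have h1 : P.S γ w i j = (P.G w *ᵥ x) i := by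
      rw [NLP.S, Matrix.mul_assoc]; rfl
    rw [Matrix.sub_apply, h1]
    rfl
  have h := norm_mulVec_condensed_sub_le (ρ := M₁ * (u / t)) hc₁.le (by positivity)
    (by positivity) (hstab (q j) (hq0 j))
    (fun z z' hz => (hpert p (q j) hp0 (hq0 j) z z' hz).trans (by gcongr; exact hpq j)) hω hx hy
  rw [hS]
  refine ((norm_le_pi_norm (F.G *ᵥ y - P.G w *ᵥ x) i).trans h).trans ?_
  -- In the second term the factor `1/Ξ` of the data error cancels against the `Ξ` of the right-hand
  -- side.
  calc _ ≤ n * (c * u) * (c₁ * (1 / a)) + n * R * (c₁ * (M₁ * (u / t)) * (t / a)) := by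
        gcongr
        exact hF.G_err
    _ = _ := by field_simp
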